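/- Let $(\mathcal Z,d)$ be a nonempty compact metric space (for example a compact subset of $\mathbb R^m$), let $\mathcal P(\mathcal Z)$ be the set of Borel probability measures on $\mathcal Z$, and let $p\ge 1$, $\varepsilon\ge 0$, $\gamma>0$. Let $W_p(\mu,\nu)=\inf_{\pi}\big(\int d(z,z')^p\,d\pi(z,z')\big)^{1/p}$, the infimum being over all couplings $\pi$ of $\mu,\nu\in\mathcal P(\mathcal Z)$, and let $D_{\mathrm{KL}}(\mu,\nu)=\int\log\frac{d\mu}{d\nu}\,d\mu$ if $\mu\ll\nu$, and $+\infty$ otherwise. For $\mathcal D_n\in\mathcal P(\mathcal Z)$ (for example the empirical distribution of $n\ge 1$ sample points) put $$\mathcal U(\mathcal D_n)=\{\mathcal D'\in\mathcal P(\mathcal Z):\ \exists\,\mathcal D''\in\mathcal P(\mathcal Z)\text{ with } W_p(\mathcal D_n,\mathcal D'')\le\varepsilon \text{ and } D_{\mathrm{KL}}(\mathcal D'',\mathcal D')\le\gamma\}.$$ Let $\Theta$ be a nonempty compact first-countable topological space (for example a compact subset of $\mathbb R^q$) and let $L:\Theta\times\mathcal Z\to\mathbb R$ satisfy: (i) for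 every $\theta\in\Theta$, $L(\theta,\cdot)$ is non-negative and upper semicontinuous on $\mathcal Z$; (ii) for every $z\in\mathcal Z$, $L(\cdot,z)$ is lower semicontinuous on $\Theta$; (iii) for every $\theta\in\Theta$ there exist $c>0$, $\hat z_0\in\mathcal Z$ and $k\in(0,p)$ such that $L(\theta,z)\le c\,[1+d(z,\hat z_0)^k]$ for all $z\in\mathcal Z$. Then the zero-sum game in which the learner first chooses $\theta\in\Theta$ to minimize, and the adversary, knowing $\theta$, then chooses $\mathcal D'\in\mathcal U(\mathcal D_n)$ to maximize, the expected loss $\mathbb E_{\mathcal D'}[L(\theta,z)]$ has a Stackelberg equilibrium. That is, for all $\theta\in\Theta$ the expectations $\mathbb E_{\mathcal D'}[L(\theta,z)]$, $\mathcal D'\in\mathcal U(\mathcal D_n)$, are finite and attain a maximum over $\mathcal U(\mathcal D_n)$, and there exist $\theta^*\in\Theta$ and $\mathcal D'^*\in\mathcal U(\mathcal D_n)$ such that $$\theta^*\in\operatorname*{arg\,min}_{\theta\in\Theta}\ \max_{\mathcal D'\in\mathcal U(\mathcal D_n)}\mathbb E_{\mathcal D'}[L(\theta,z)],\qquad \mathcal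 D'^*\in\operatorname*{arg\,max}_{\mathcal D'\in\mathcal U(\mathcal D_n)}\mathbb E_{\mathcal D'}[L(\theta^*,z)].$$ -/

import Mathlib

open MeasureTheory
open scoped ENNReal

namespace SRWDRO

noncomputable section

/-- The couplings of `μ` and `ν`: measures on the product with marginals `μ` and `ν` (these are
automatically probability measures when `μ` and `ν` are). -/
def couplings {Z : Type*} [MeasurableSpace Z] (μ ν : Measure Z) : Set (Measure (Z × Z)) :=
  {π | π.map Prod.fst = μ ∧ π.map Prod.snd = ν}

/-- The `p`-th Wasserstein distance
`inf { (∫ d(z, z') ^ p dπ(z, z')) ^ (1 / p) | π a coupling of μ and ν }`, as an extended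
nonnegative real. -/
def wasserstein {Z : Type*} [MetricSpace Z] [MeasurableSpace Z] (p : ℝ) (μ ν : Measure Z) :
    ℝ≥0∞ :=
  ⨅ π ∈ couplings μ ν, (∫⁻ x, edist x.1 x.2 ^ p ∂π) ^ (1 / p)

/-- The ambiguity set: the laws `D'` for which there is a law `D''` with `W_p(D₀, D'') ≤ ε` and
`KL(D'' ‖ D') ≤ γ`. -/
def ambiguitySet {Z : Type*} [MetricSpace Z] [MeasurableSpace Z] (p ε γ : ℝ)
    (D₀ : ProbabilityMeasure Z) : Set (ProbabilityMeasure Z) :=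
  {D' | ∃ D'' : ProbabilityMeasure Z,
    wasserstein p (D₀ : Measure Z) (D'' : Measure Z) ≤ ENNReal.ofReal ε ∧
    InformationTheory.klDiv (D'' : Measure Z) (D' : Measure Z) ≤ ENNReal.ofReal γ}

/-- The expected loss of the model `θ` under the law `D`. -/
def expectedLoss {Θ Z : Type*} [MeasurableSpace Z] (L : Θ → Z → ℝ) (θ : Θ)
    (D : ProbabilityMeasure Z) : ℝ :=
  ∫ z, L θ z ∂(D : Measure Z)

/-- The worst-case loss of the leader's strategy `x` when the follower picks a strategy in `S` so
as to maximize `loss x`. -/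
def worstCase {X Y : Type*} (loss : X → Y → ℝ) (S : Set Y) (x : X) : ℝ :=
  sSup (loss x '' S)

/-- The best responses of the follower to `x`, i.e. the maximizers of `loss x` over `S`. -/
def bestResponses {X Y : Type*} (loss : X → Y → ℝ) (S : Set Y) (x : X) : Set Y :=
  {y | y ∈ S ∧ ∀ y' ∈ S, loss x y' ≤ loss x y}

/-- Stackelberg equilibrium of the zero-sum game in which the leader first picks `x`, aiming at a
small `loss`, and the follower, knowing `x`, then picks `y ∈ S`, aiming at a large `loss`. It
requires that the worst case be an attained maximum for every `x`, that the leader minimize this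
maximum, and that the follower's strategy be a best response to the leader's one. -/
structure IsStackelbergEquilibrium {X Y : Type*} (loss : X → Y → ℝ) (S : Set Y)
    (xs : X) (ys : Y) : Prop where
  isGreatest_worstCase : ∀ x, IsGreatest (loss x '' S) (worstCase loss S x)
  leader_optimal : ∀ x, worstCase loss S xs ≤ worstCase loss S x
  follower_best_response : ys ∈ bestResponses loss S xs

end

end SRWDRO

/-!
The set of laws on the compact space `Z` is compact for weak convergence, and the ambiguity set is
a compact subset of it. Indeed it is the second projection of the set of pairs `(D'', D')` with
`W_p(D₀, D'') ≤ ε` and `KL(D'' ‖ D') ≤ γ`, and both constraints are closed. For the Wasserstein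
ball this is compactness of the set of couplings with a bounded cost
(`isClosed_setOf_wasserstein_le`). For the divergence it is the variational formula
`KL(μ ‖ ν) = sup_f (∫ f dμ - ∫ exp f dν + 1)` over continuous `f`
(`klDiv_le_iff_forall_continuous`): Fenchel–Young gives one inequality; for the other, density in
`L¹(μ + ν)` extends the supremum to bounded measurable `f`, and Fatou's lemma is applied to the
truncations of `f = log (dμ/dν)`.

For a fixed `θ` the loss is upper semicontinuous and bounded, so by the portmanteau theorem its
expectation is upper semicontinuous in the law (`upperSemicontinuous_integral`) and attains a
maximum on the ambiguity set. For a fixed law the expectation is lower semicontinuous in `θ` by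
Fatou's lemma; first countability makes the neighborhood filters countably generated, as that lemma
requires. The worst case, a supremum of lower semicontinuous functions, thus attains its minimum on
the compact space `Θ` (`exists_isStackelbergEquilibrium`).
-/

namespace SRWDRO

open Filter Topology InformationTheory
open scoped NNReal

variable {Z : Type*} [MeasurableSpace Z]

/-! ### Semicontinuity of expectations -/

/-- Fatou's lemma in terms of semicontinuity. -/
lemma lowerSemicontinuous_lintegral {X : Type*} [TopologicalSpace X] [FirstCountableTopology X]
    {f : X → Z → ℝ≥0∞} (μ : Measure Z) (hmeas : ∀ x, Measurable (f x))
    (hlsc : ∀ z, LowerSemicontinuous fun x => f x z) :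
    LowerSemicontinuous fun x => ∫⁻ z, f x z ∂μ := by
  rw [lowerSemicontinuous_iff_le_liminf]
  intro x
  calc ∫⁻ z, f x z ∂μ ≤ ∫⁻ z, liminf (fun y => f y z) (𝓝 x) ∂μ :=
        lintegral_mono fun z => lowerSemicontinuous_iff_le_liminf.1 (hlsc z) x
    _ ≤ _ := lintegral_liminf_le hmeas

lemma lowerSemicontinuous_of_ofReal {X : Type*} [TopologicalSpace X] {F : X → ℝ}
    (hF : ∀ x, 0 ≤ F x) (h : LowerSemicontinuous fun x => ENNReal.ofReal (F x)) :
    LowerSemicontinuous F := by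
  intro x a ha
  rcases lt_or_ge a 0 with h0 | h0
  · exact .of_forall fun y => h0.trans_le (hF y)
  · filter_upwards [h x (ENNReal.ofReal a)
      ((ENNReal.ofReal_lt_ofReal_iff_of_nonneg h0).2 ha)] with y hy
    exact (ENNReal.ofReal_lt_ofReal_iff_of_nonneg h0).1 hy

section Portmanteau

variable [TopologicalSpace Z] [HasOuterApproxClosed Z] [BorelSpace Z]

lemma lowerSemicontinuous_measure_of_isOpen {G : Set Z} (hG : IsOpen G) :
    LowerSemicontinuous fun μ : ProbabilityMeasure Z => (μ : Measure Z) G := by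
  rw [lowerSemicontinuous_iff_le_liminf]
  intro μ
  exact ProbabilityMeasure.le_liminf_measure_open_of_tendsto tendsto_id hG

variable [FirstCountableTopology (ProbabilityMeasure Z)]

/-- The layer cake formula writes the integral as an integral over the levels `t` of the measures
of the open sets `{t < f}`. -/
lemma lowerSemicontinuous_lintegral_ofReal {f : Z → ℝ} (hf : LowerSemicontinuous f)
    (hf0 : ∀ z, 0 ≤ f z) :
    LowerSemicontinuous fun μ : ProbabilityMeasure Z =>
      ∫⁻ z, ENNReal.ofReal (f z) ∂(μ : Measure Z) := by
  simp_rw [fun μ : ProbabilityMeasure Z => lintegral_eq_lintegral_meas_lt (μ : Measure Z)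
    (Eventually.of_forall hf0) hf.measurable.aemeasurable]
  refine lowerSemicontinuous_lintegral _ (fun μ => ?_) fun t => ?_
  · exact Antitone.measurable fun s t hst => measure_mono fun z hz => lt_of_le_of_lt hst hz
  · exact lowerSemicontinuous_measure_of_isOpen (hf.isOpen_preimage t)

lemma upperSemicontinuous_integral {f : Z → ℝ} (hf : UpperSemicontinuous f) {M : ℝ}
    (hf0 : ∀ z, 0 ≤ f z) (hfM : ∀ z, f z ≤ M) :
    UpperSemicontinuous fun μ : ProbabilityMeasure Z => ∫ z, f z ∂(μ : Measure Z) := by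
  have hint (μ : ProbabilityMeasure Z) : Integrable f (μ : Measure Z) :=
    .of_bound hf.measurable.aestronglyMeasurable M
      (.of_forall fun z => by rw [Real.norm_of_nonneg (hf0 z)]; exact hfM z)
  have heq (μ : ProbabilityMeasure Z) : ∫⁻ z, ENNReal.ofReal (M - f z) ∂(μ : Measure Z)
      = ENNReal.ofReal (M - ∫ z, f z ∂(μ : Measure Z)) := by
    have h := ofReal_integral_eq_lintegral_ofReal ((integrable_const M).sub (hint μ))
      (.of_forall fun z => sub_nonneg.2 (hfM z))
    rw [integral_sub' (integrable_const M) (hint μ)] at h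
    simpa using h.symm
  have hlsc : LowerSemicontinuous fun z => M - f z := by
    intro z y hy
    filter_upwards [hf z (M - y) (by linarith)] with w hw
    linarith
  have key := lowerSemicontinuous_lintegral_ofReal hlsc fun z => sub_nonneg.2 (hfM z)
  simp_rw [heq] at key
  have hle (μ : ProbabilityMeasure Z) : 0 ≤ M - ∫ z, f z ∂(μ : Measure Z) :=
    sub_nonneg.2 (by simpa using integral_mono (hint μ) (integrable_const M) hfM)
  intro μ y hy
  filter_upwards [lowerSemicontinuous_of_ofReal hle key μ (M - y) (sub_lt_sub_left hy M)]
    with ν hν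
  exact (sub_lt_sub_iff_left M).1 hν

end Portmanteau

/-! ### A variational formula for the Kullback–Leibler divergence -/

/-- The Fenchel–Young inequality for `klFun` and its conjugate `x ↦ exp x - 1`. -/
lemma mul_sub_exp_add_one_le_klFun {g : ℝ} (hg : 0 ≤ g) (x : ℝ) :
    g * x - Real.exp x + 1 ≤ klFun g := by
  rw [klFun_apply]
  rcases hg.eq_or_lt with rfl | hg
  · simp [Real.exp_nonneg]
  · have h := Real.add_one_le_exp (x - Real.log g)
    rw [Real.exp_sub, Real.exp_log hg, le_div_iff₀ hg] at h
    linarith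

/-- With `c` the truncation of `g` to `[1 / (n + 1), n + 1]`, the Fenchel–Young lower bound of
`klFun g` at the point `log c` is nonnegative, so that Fatou's lemma applies as `n → ∞`. -/
lemma mul_log_clamp_nonneg (g : ℝ) (n : ℕ) :
    0 ≤ g * Real.log (max (1 / (n + 1 : ℝ)) (min g (n + 1)))
      - max (1 / (n + 1 : ℝ)) (min g (n + 1)) + 1 := by
  have hn : (1 : ℝ) ≤ n + 1 := by simp
  have hn' : 1 / (n + 1 : ℝ) ≤ 1 := by rw [div_le_one (by linarith)]; exact hn
  set a : ℝ := 1 / (n + 1)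
  set c := max a (min g (n + 1)) with hc
  have ha : 0 < a := by positivity
  have hcpos : 0 < c := ha.trans_le (le_max_left _ _)
  have h1 : 0 ≤ klFun c := klFun_nonneg hcpos.le
  rw [klFun_apply] at h1
  -- `g - c` and `log c` have the same sign
  have h2 : 0 ≤ (g - c) * Real.log c := by
    rcases le_total g c with h | h
    · rcases h.eq_or_lt with h | h
      · simp [← h]
      · have : c = a := by grind
        exact mul_nonneg_of_nonpos_of_nonpos (by linarith)
          (Real.log_nonpos hcpos.le (this ▸ hn'))
    · rcases h.eq_or_lt with h | h
      · simp [← h]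
      · have : c = n + 1 := by grind
        exact mul_nonneg (by linarith) (Real.log_nonneg (this ▸ hn))
  linarith

lemma tendsto_mul_log_clamp {g : ℝ} (hg : 0 ≤ g) :
    Tendsto (fun n : ℕ => g * Real.log (max (1 / (n + 1 : ℝ)) (min g (n + 1)))
      - max (1 / (n + 1 : ℝ)) (min g (n + 1)) + 1) atTop (𝓝 (klFun g)) := by
  have h0 := tendsto_one_div_add_atTop_nhds_zero_nat (𝕜 := ℝ)
  rcases hg.eq_or_lt with rfl | hg
  · have h (n : ℕ) : max (1 / (n + 1 : ℝ)) (min 0 (n + 1)) = 1 / (n + 1 : ℝ) := by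
      rw [min_eq_left (by positivity), max_eq_left (by positivity)]
    simp_rw [h]
    simpa [klFun_zero] using (h0.const_sub 0).add_const 1
  · refine tendsto_const_nhds.congr' ?_
    filter_upwards [h0.eventually_lt_const hg, eventually_ge_atTop ⌈g⌉₊] with n h1 h2
    have h3 : g ≤ n + 1 := by
      have := (Nat.le_ceil g).trans (Nat.cast_le.2 h2)
      linarith
    rw [min_eq_left h3, max_eq_right h1.le, klFun_apply]
    ring

section Dual

variable {μ ν : Measure Z} [IsProbabilityMeasure μ] [IsProbabilityMeasure ν] {γ : ℝ}

lemma integral_sub_integral_exp_add_one_le (h : klDiv μ ν ≤ ENNReal.ofReal γ) (hγ : 0 ≤ γ)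
    {f : Z → ℝ} {C : ℝ} (hf : Measurable f) (hfC : ∀ z, |f z| ≤ C) :
    ∫ z, f z ∂μ - ∫ z, Real.exp (f z) ∂ν + 1 ≤ γ := by
  obtain ⟨hac, hllr⟩ := klDiv_ne_top_iff.1 (h.trans_lt ENNReal.ofReal_lt_top).ne
  have hk : ∫ z, klFun (μ.rnDeriv ν z).toReal ∂ν ≤ γ := by
    rw [← toReal_klDiv_eq_integral_klFun hac]
    exact ENNReal.toReal_le_of_le_ofReal hγ h
  have hkint := (integrable_klFun_rnDeriv_iff hac).2 hllr
  have hexp : Integrable (fun z => Real.exp (f z)) ν :=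
    .of_bound hf.exp.aestronglyMeasurable (Real.exp C) (.of_forall fun z => by
      rw [Real.norm_of_nonneg (Real.exp_nonneg _)]
      exact Real.exp_le_exp.2 ((le_abs_self _).trans (hfC z)))
  have hfint : Integrable (fun z => (μ.rnDeriv ν z).toReal * f z) ν :=
    (integrable_rnDeriv_smul_iff hac).2
      (.of_bound hf.aestronglyMeasurable C (.of_forall hfC))
  have heq : ∫ z, f z ∂μ - ∫ z, Real.exp (f z) ∂ν + 1
      = ∫ z, ((μ.rnDeriv ν z).toReal * f z - Real.exp (f z) + 1) ∂ν := by
    rw [integral_add (f := fun z => (μ.rnDeriv ν z).toReal * f z - Real.exp (f z))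
      (hfint.sub hexp) (integrable_const _), integral_sub hfint hexp, ← integral_rnDeriv_smul hac]
    simp
  rw [heq]
  refine (integral_mono ((hfint.sub hexp).add (integrable_const _)) hkint fun z => ?_).trans hk
  exact mul_sub_exp_add_one_le_klFun ENNReal.toReal_nonneg _

lemma klDiv_le_of_forall_measurable
    (h : ∀ (f : Z → ℝ) (C : ℝ), Measurable f → (∀ z, |f z| ≤ C) →
      ∫ z, f z ∂μ - ∫ z, Real.exp (f z) ∂ν + 1 ≤ γ) :
    klDiv μ ν ≤ ENNReal.ofReal γ := by
  -- Multiples of the indicator of a `ν`-null set force it to be `μ`-null.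
  have hac : μ ≪ ν := by
    refine Measure.AbsolutelyContinuous.mk fun A hA hνA => ?_
    by_contra hμA
    have hpos : 0 < μ.real A := ENNReal.toReal_pos hμA (measure_ne_top _ _)
    set t : ℝ := (|γ| + 1) / μ.real A
    have ht : 0 ≤ t := by positivity
    have h1 := h (A.indicator fun _ => t) t (measurable_const.indicator hA) fun z => by
      by_cases hz : z ∈ A <;> simp [hz, abs_of_nonneg ht, ht]
    have h2 : ∫ z, Real.exp (A.indicator (fun _ => t) z) ∂ν = 1 := by
      have : (fun z => Real.exp (A.indicator (fun _ => t) z)) =ᵐ[ν] fun _ => (1 : ℝ) := by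
        filter_upwards [measure_eq_zero_iff_ae_notMem.1 hνA] with z hz
        simp [hz]
      rw [integral_congr_ae this]
      simp
    rw [h2, integral_indicator_const _ hA, smul_eq_mul, mul_div_cancel₀ _ hpos.ne'] at h1
    linarith [le_abs_self γ]
  rw [klDiv_eq_lintegral_klFun_of_ac hac]
  set g : Z → ℝ := fun z => (μ.rnDeriv ν z).toReal
  have hgm : Measurable g := (Measure.measurable_rnDeriv μ ν).ennreal_toReal
  set c : ℕ → Z → ℝ := fun n z => max (1 / (n + 1 : ℝ)) (min (g z) (n + 1)) with hc
  have hcm (n : ℕ) : Measurable (c n) :=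
    measurable_const.max (hgm.min measurable_const)
  have hcpos (n : ℕ) (z : Z) : 0 < c n z := lt_max_of_lt_left (by positivity)
  have hcle (n : ℕ) (z : Z) : c n z ≤ n + 1 := by
    refine max_le ?_ (min_le_right _ _)
    rw [div_le_iff₀ (by positivity)]
    nlinarith [(n.cast_nonneg : (0 : ℝ) ≤ n)]
  have hlogC (n : ℕ) (z : Z) : |Real.log (c n z)| ≤ Real.log (n + 1) := by
    rw [abs_le, ← Real.log_inv, ← one_div]
    exact ⟨Real.log_le_log (by positivity) (le_max_left _ _),
      Real.log_le_log (hcpos n z) (hcle n z)⟩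
  have hcint (n : ℕ) : Integrable (c n) ν :=
    .of_bound (hcm n).aestronglyMeasurable (n + 1) (.of_forall fun z => by
      rw [Real.norm_of_nonneg (hcpos n z).le]; exact hcle n z)
  have hlint (n : ℕ) : Integrable (fun z => g z * Real.log (c n z)) ν :=
    (integrable_rnDeriv_smul_iff hac).2
      (.of_bound (hcm n).log.aestronglyMeasurable _ (.of_forall (hlogC n)))
  have hbound (n : ℕ) :
      ∫⁻ z, ENNReal.ofReal (g z * Real.log (c n z) - c n z + 1) ∂ν ≤ ENNReal.ofReal γ := by
    rw [← ofReal_integral_eq_lintegral_ofReal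
      (f := fun z => g z * Real.log (c n z) - c n z + 1)
      (((hlint n).sub (hcint n)).add (integrable_const _))
      (.of_forall fun z => mul_log_clamp_nonneg (g z) n)]
    refine ENNReal.ofReal_le_ofReal ?_
    have h1 := h _ _ (hcm n).log (hlogC n)
    simp_rw [Real.exp_log (hcpos n _)] at h1
    rw [integral_add (f := fun z => g z * Real.log (c n z) - c n z)
      ((hlint n).sub (hcint n)) (integrable_const _), integral_sub (hlint n) (hcint n)]
    have h2 : ∫ z, g z * Real.log (c n z) ∂ν = ∫ z, Real.log (c n z) ∂μ :=
      integral_rnDeriv_smul hac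
    rw [h2]
    simpa using h1
  calc ∫⁻ z, ENNReal.ofReal (klFun (g z)) ∂ν
      = ∫⁻ z, liminf (fun n => ENNReal.ofReal (g z * Real.log (c n z) - c n z + 1)) atTop ∂ν :=
        lintegral_congr fun z => ((ENNReal.continuous_ofReal.tendsto _).comp
          (tendsto_mul_log_clamp (g := g z) ENNReal.toReal_nonneg)).liminf_eq.symm
    _ ≤ liminf (fun n => ∫⁻ z, ENNReal.ofReal (g z * Real.log (c n z) - c n z + 1) ∂ν) atTop :=
        lintegral_liminf_le fun n =>
          (((hgm.mul (hcm n).log).sub (hcm n)).add_const 1).ennreal_ofReal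
    _ ≤ ENNReal.ofReal γ := liminf_le_of_frequently_le' (.of_forall hbound)

variable [TopologicalSpace Z] [NormalSpace Z] [BorelSpace Z]

/-- By density of the continuous functions in `L¹(μ + ν)`. -/
lemma integral_sub_integral_exp_add_one_le_of_forall_continuous [(μ + ν).WeaklyRegular]
    (h : ∀ f : C(Z, ℝ), ∫ z, f z ∂μ - ∫ z, Real.exp (f z) ∂ν + 1 ≤ γ)
    {f : Z → ℝ} {C : ℝ} (hf : Measurable f) (hfC : ∀ z, |f z| ≤ C) :
    ∫ z, f z ∂μ - ∫ z, Real.exp (f z) ∂ν + 1 ≤ γ := by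
  have hint {ρ : Measure Z} [IsFiniteMeasure ρ] {u : Z → ℝ} (hu : Measurable u)
      (huC : ∀ z, |u z| ≤ C) : Integrable u ρ :=
    .of_bound hu.aestronglyMeasurable C (.of_forall huC)
  have hexp {u : Z → ℝ} (hu : Measurable u) (huC : ∀ z, |u z| ≤ C) :
      Integrable (fun z => Real.exp (u z)) ν :=
    .of_bound hu.exp.aestronglyMeasurable (Real.exp C) (.of_forall fun z => by
      rw [Real.norm_of_nonneg (Real.exp_nonneg _)]
      exact Real.exp_le_exp.2 ((le_abs_self _).trans (huC z)))
  have key (δ : ℝ) (hδ : 0 < δ) :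
      ∫ z, f z ∂μ - ∫ z, Real.exp (f z) ∂ν + 1 ≤ γ + δ * (1 + Real.exp C) := by
    obtain ⟨g, hg, hgi⟩ :=
      (hint (ρ := μ + ν) hf hfC).exists_boundedContinuous_integral_sub_le hδ
    -- Truncation makes the approximation obey the bound of `f`, and keeps it close to `f`.
    let u : C(Z, ℝ) := ⟨fun z => max (-C) (min (g z) C), by fun_prop⟩
    have hu (z : Z) : u z = max (-C) (min (g z) C) := rfl
    have huC (z : Z) : |u z| ≤ C := by
      have := hfC z
      have := abs_nonneg (f z)
      rw [hu, abs_le]; grind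
    have hum : Measurable u := u.continuous.measurable
    have hufg (z : Z) : |f z - u z| ≤ |f z - g z| := by
      have := abs_le.1 (hfC z)
      rw [hu]; grind
    have hd (ρ : Measure Z) [IsFiniteMeasure ρ] : Integrable (fun z => |f z - u z|) ρ :=
      ((hint hf hfC).sub (hint hum huC)).abs
    have hclose : ∫ z, |f z - u z| ∂μ + ∫ z, |f z - u z| ∂ν ≤ δ := by
      rw [← integral_add_measure (hd μ) (hd ν)]
      refine (integral_mono (hd _) ?_ hufg).trans hg
      exact ((hint hf hfC).sub hgi).abs
    have h0μ : 0 ≤ ∫ z, |f z - u z| ∂μ := integral_nonneg fun _ => abs_nonneg _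
    have h0ν : 0 ≤ ∫ z, |f z - u z| ∂ν := integral_nonneg fun _ => abs_nonneg _
    have h1 : ∫ z, f z ∂μ - ∫ z, u z ∂μ ≤ ∫ z, |f z - u z| ∂μ := by
      rw [← integral_sub (hint hf hfC) (hint hum huC)]
      exact integral_mono ((hint hf hfC).sub (hint hum huC)) (hd μ) fun z => le_abs_self _
    have h2 : ∫ z, Real.exp (u z) ∂ν - ∫ z, Real.exp (f z) ∂ν
        ≤ Real.exp C * ∫ z, |f z - u z| ∂ν := by
      rw [← integral_sub (hexp hum huC) (hexp hf hfC), ← integral_const_mul]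
      refine integral_mono ((hexp hum huC).sub (hexp hf hfC)) ((hd ν).const_mul _) fun z => ?_
      have h3 := Real.add_one_le_exp (f z - u z)
      have h4 : Real.exp (f z) = Real.exp (u z) * Real.exp (f z - u z) := by
        rw [← Real.exp_add]; congr 1; ring
      have h5 : Real.exp (u z) ≤ Real.exp C :=
        Real.exp_le_exp.2 ((le_abs_self _).trans (huC z))
      calc Real.exp (u z) - Real.exp (f z) = Real.exp (u z) * (1 - Real.exp (f z - u z)) := by
            rw [h4]; ring
        _ ≤ Real.exp (u z) * |f z - u z| :=
            mul_le_mul_of_nonneg_left (by linarith [neg_abs_le (f z - u z)]) (Real.exp_nonneg _)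
        _ ≤ Real.exp C * |f z - u z| := mul_le_mul_of_nonneg_right h5 (abs_nonneg _)
    have h3 := h u
    have h4 : Real.exp C * ∫ z, |f z - u z| ∂ν ≤ Real.exp C * δ :=
      mul_le_mul_of_nonneg_left (by linarith) (Real.exp_nonneg _)
    linarith
  refine le_of_forall_pos_le_add fun η hη => ?_
  have hpos : 0 < 1 + Real.exp C := by positivity
  have := key (η / (1 + Real.exp C)) (by positivity)
  rwa [div_mul_cancel₀ _ hpos.ne'] at this

/-- A Donsker–Varadhan type duality: the divergence is a supremum of functionals that are continuous
in `(μ, ν)`, hence it is jointly lower semicontinuous. -/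
lemma klDiv_le_iff_forall_continuous [CompactSpace Z] [(μ + ν).WeaklyRegular] (hγ : 0 ≤ γ) :
    klDiv μ ν ≤ ENNReal.ofReal γ ↔
      ∀ f : C(Z, ℝ), ∫ z, f z ∂μ - ∫ z, Real.exp (f z) ∂ν + 1 ≤ γ :=
  ⟨fun h f => integral_sub_integral_exp_add_one_le h hγ f.continuous.measurable f.norm_coe_le_norm,
    fun h => klDiv_le_of_forall_measurable fun _ _ hf hfC =>
      integral_sub_integral_exp_add_one_le_of_forall_continuous h hf hfC⟩

end Dual

/-! ### Compactness of the ambiguity set -/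

section Compact

variable [MetricSpace Z] [CompactSpace Z] [BorelSpace Z]

lemma isClosed_setOf_klDiv_le {γ : ℝ} (hγ : 0 ≤ γ) :
    IsClosed {q : ProbabilityMeasure Z × ProbabilityMeasure Z |
      klDiv (q.1 : Measure Z) (q.2 : Measure Z) ≤ ENNReal.ofReal γ} := by
  simp_rw [klDiv_le_iff_forall_continuous hγ, Set.ofPred_forall]
  refine isClosed_iInter fun f => isClosed_le ?_ continuous_const
  let e : C(Z, ℝ) := ⟨fun z => Real.exp (f z), by fun_prop⟩
  have h1 := (ProbabilityMeasure.continuous_integral_continuousMap f).comp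
    (continuous_fst (X := ProbabilityMeasure Z) (Y := ProbabilityMeasure Z))
  have h2 := (ProbabilityMeasure.continuous_integral_continuousMap e).comp
    (continuous_snd (X := ProbabilityMeasure Z) (Y := ProbabilityMeasure Z))
  exact (h1.sub h2).add continuous_const

variable {p : ℝ}

lemma continuous_lintegral_edist_rpow (hp : 0 ≤ p) :
    Continuous fun π : ProbabilityMeasure (Z × Z) =>
      ∫⁻ x, edist x.1 x.2 ^ p ∂(π : Measure (Z × Z)) := by
  let f : C(Z × Z, ℝ≥0) := ⟨fun x => nndist x.1 x.2 ^ p,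
    (NNReal.continuous_rpow_const hp).comp (by fun_prop)⟩
  convert ProbabilityMeasure.continuous_lintegral_continuousMap f using 4 with π x
  rw [edist_nndist, ← ENNReal.coe_rpow_of_nonneg _ hp]
  rfl

lemma wasserstein_self (hp : 0 < p) (μ : Measure Z) : wasserstein p μ μ = 0 := by
  have hmeas : Measurable fun z : Z => (z, z) := measurable_id.prodMk measurable_id
  refine le_antisymm (iInf₂_le_of_le (μ.map fun z => (z, z)) ⟨?_, ?_⟩ ?_) zero_le
  · rw [Measure.map_map measurable_fst hmeas]; exact Measure.map_id
  · rw [Measure.map_map measurable_snd hmeas]; exact Measure.map_id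
  · have hm : Measurable fun x : Z × Z => edist x.1 x.2 ^ p := measurable_edist.pow_const p
    rw [lintegral_map hm hmeas]
    simp [hp]

/-- Couplings of `μ` with cost at most `c` form a compact set, so their second marginals do too. -/
lemma isCompact_setOf_exists_coupling (hp : 0 < p) (μ : ProbabilityMeasure Z) (c : ℝ≥0∞) :
    IsCompact {ν : ProbabilityMeasure Z | ∃ π ∈ couplings (μ : Measure Z) (ν : Measure Z),
      (∫⁻ x, edist x.1 x.2 ^ p ∂π) ^ (1 / p) ≤ c} := by
  let m₁ : ProbabilityMeasure (Z × Z) → ProbabilityMeasure Z := fun π =>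
    π.map (continuous_fst (X := Z) (Y := Z)).measurable.aemeasurable
  let m₂ : ProbabilityMeasure (Z × Z) → ProbabilityMeasure Z := fun π =>
    π.map (continuous_snd (X := Z) (Y := Z)).measurable.aemeasurable
  have hm₁ : Continuous m₁ := ProbabilityMeasure.continuous_map continuous_fst
  have hm₂ : Continuous m₂ := ProbabilityMeasure.continuous_map continuous_snd
  have hcost : Continuous fun π : ProbabilityMeasure (Z × Z) =>
      (∫⁻ x, edist x.1 x.2 ^ p ∂(π : Measure (Z × Z))) ^ (1 / p) :=
    ENNReal.continuous_rpow_const.comp (continuous_lintegral_edist_rpow hp.le)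
  have hK : IsCompact {π : ProbabilityMeasure (Z × Z) | m₁ π = μ ∧
      (∫⁻ x, edist x.1 x.2 ^ p ∂(π : Measure (Z × Z))) ^ (1 / p) ≤ c} :=
    ((isClosed_eq hm₁ continuous_const).inter (isClosed_le hcost continuous_const)).isCompact
  convert hK.image hm₂ using 1
  ext ν
  constructor
  · rintro ⟨π, ⟨h1, h2⟩, h3⟩
    have : IsProbabilityMeasure (π.map Prod.fst) := by rw [h1]; infer_instance
    have hπ : IsProbabilityMeasure π :=
      Measure.isProbabilityMeasure_of_map Prod.fst
    exact ⟨⟨π, hπ⟩, ⟨Subtype.ext h1, h3⟩, Subtype.ext h2⟩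
  · rintro ⟨π, ⟨h1, h3⟩, h2⟩
    exact ⟨π, ⟨congrArg Subtype.val h1, congrArg Subtype.val h2⟩, h3⟩

lemma isClosed_setOf_wasserstein_le (hp : 0 < p) (μ : ProbabilityMeasure Z) (r : ℝ≥0∞) :
    IsClosed {ν : ProbabilityMeasure Z | wasserstein p (μ : Measure Z) (ν : Measure Z) ≤ r} := by
  have : {ν : ProbabilityMeasure Z | wasserstein p (μ : Measure Z) (ν : Measure Z) ≤ r} =
      ⋂ c > r, {ν : ProbabilityMeasure Z | ∃ π ∈ couplings (μ : Measure Z) (ν : Measure Z),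
        (∫⁻ x, edist x.1 x.2 ^ p ∂π) ^ (1 / p) ≤ c} := by
    ext ν
    simp only [Set.mem_ofPred_eq, Set.mem_iInter]
    constructor
    · intro h c hc
      obtain ⟨π, hπ⟩ := iInf_lt_iff.1 (h.trans_lt hc)
      obtain ⟨hπ, hlt⟩ := iInf_lt_iff.1 hπ
      exact ⟨π, hπ, hlt.le⟩
    · intro h
      refine le_of_forall_gt_imp_ge_of_dense fun c hc => ?_
      obtain ⟨π, hπ, hle⟩ := h c hc
      exact iInf₂_le_of_le π hπ hle
  rw [this]
  exact isClosed_biInter fun c _ => (isCompact_setOf_exists_coupling hp μ c).isClosed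

lemma isCompact_ambiguitySet {ε γ : ℝ} (hp : 0 < p) (hγ : 0 ≤ γ) (μ : ProbabilityMeasure Z) :
    IsCompact (ambiguitySet p ε γ μ) := by
  have hK : IsCompact {q : ProbabilityMeasure Z × ProbabilityMeasure Z |
      wasserstein p (μ : Measure Z) (q.1 : Measure Z) ≤ ENNReal.ofReal ε ∧
      klDiv (q.1 : Measure Z) (q.2 : Measure Z) ≤ ENNReal.ofReal γ} :=
    (((isClosed_setOf_wasserstein_le hp μ _).preimage continuous_fst).inter
      (isClosed_setOf_klDiv_le hγ)).isCompact
  convert hK.image continuous_snd using 1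
  ext ν
  simp [ambiguitySet]

lemma self_mem_ambiguitySet {ε γ : ℝ} (hp : 0 < p) (μ : ProbabilityMeasure Z) :
    μ ∈ ambiguitySet p ε γ μ :=
  ⟨μ, by simp [wasserstein_self hp], by simp [klDiv_self]⟩

end Compact

/-! ### Existence of Stackelberg equilibria -/

/-- If the follower always has a best response `y x`, then the worst case
`loss x (y x)` dominates every `loss x y`; lower semicontinuity in `x` of the latter therefore
passes to the worst case, which then has a minimizer. -/
lemma exists_isStackelbergEquilibrium {X Y : Type*} [TopologicalSpace X] [CompactSpace X]
    [Nonempty X] {loss : X → Y → ℝ} {S : Set Y}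
    (hresp : ∀ x, (bestResponses loss S x).Nonempty)
    (hlsc : ∀ y ∈ S, LowerSemicontinuous fun x => loss x y) :
    ∃ xs ys, IsStackelbergEquilibrium loss S xs ys := by
  choose y hyS hy using hresp
  have hgr (x : X) : IsGreatest (loss x '' S) (loss x (y x)) :=
    ⟨Set.mem_image_of_mem _ (hyS x), Set.forall_mem_image.2 (hy x)⟩
  have hwc (x : X) : worstCase loss S x = loss x (y x) := (hgr x).csSup_eq
  have hlscw : LowerSemicontinuous (worstCase loss S) := by
    intro x a ha
    rw [hwc] at ha
    filter_upwards [hlsc (y x) (hyS x) x a ha] with x' hx'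
    exact hx'.trans_le (hwc x' ▸ hy x' (y x) (hyS x))
  obtain ⟨xs, -, hxs⟩ :=
    (hlscw.lowerSemicontinuousOn Set.univ).exists_isMinOn Set.univ_nonempty isCompact_univ
  exact ⟨xs, y xs, fun x => hwc x ▸ hgr x, fun x => hxs (Set.mem_univ x), hyS xs, hy xs⟩

lemma lowerSemicontinuous_expectedLoss {Θ : Type*} [TopologicalSpace Θ]
    [FirstCountableTopology Θ] {L : Θ → Z → ℝ} (D : ProbabilityMeasure Z)
    (hL0 : ∀ θ z, 0 ≤ L θ z) (hint : ∀ θ, Integrable (L θ) (D : Measure Z))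
    (hmeas : ∀ θ, Measurable (L θ)) (hlsc : ∀ z, LowerSemicontinuous fun θ => L θ z) :
    LowerSemicontinuous fun θ => expectedLoss L θ D := by
  have key := lowerSemicontinuous_lintegral (f := fun θ z => ENNReal.ofReal (L θ z))
    (D : Measure Z) (fun θ => (hmeas θ).ennreal_ofReal)
    fun z => ENNReal.continuous_ofReal.comp_lowerSemicontinuous (hlsc z)
      fun _ _ h => ENNReal.ofReal_le_ofReal h
  have heq (θ : Θ) : ∫⁻ z, ENNReal.ofReal (L θ z) ∂(D : Measure Z)
      = ENNReal.ofReal (expectedLoss L θ D) :=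
    (ofReal_integral_eq_lintegral_ofReal (hint θ) (.of_forall (hL0 θ))).symm
  simp_rw [heq] at key
  exact lowerSemicontinuous_of_ofReal (fun θ => integral_nonneg (hL0 θ)) key

end SRWDRO

theorem theorem3 {Z Θ : Type*}
    [MetricSpace Z] [CompactSpace Z] [Nonempty Z] [MeasurableSpace Z] [BorelSpace Z]
    [TopologicalSpace Θ] [FirstCountableTopology Θ] [CompactSpace Θ] [Nonempty Θ]
    (p ε γ : ℝ) (hp : 1 ≤ p) (hε : 0 ≤ ε) (hγ : 0 < γ)
    (Dn : ProbabilityMeasure Z) (L : Θ → Z → ℝ)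
    (hL_nonneg : ∀ θ z, 0 ≤ L θ z)
    (hL_usc : ∀ θ, UpperSemicontinuous (L θ))
    (hL_lsc : ∀ z, LowerSemicontinuous (fun θ => L θ z))
    (hL_growth : ∀ θ, ∃ c : ℝ, 0 < c ∧ ∃ z₀ : Z, ∃ k : ℝ, 0 < k ∧ k < p ∧
      ∀ z, L θ z ≤ c * (1 + dist z z₀ ^ k)) :
    (∀ θ, ∀ D ∈ SRWDRO.ambiguitySet p ε γ Dn, Integrable (L θ) (D : Measure Z)) ∧
    ∃ (θs : Θ) (Ds : ProbabilityMeasure Z),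
      SRWDRO.IsStackelbergEquilibrium (SRWDRO.expectedLoss L)
        (SRWDRO.ambiguitySet p ε γ Dn) θs Ds := by
  have hp0 : 0 < p := zero_lt_one.trans_le hp
  -- An upper semicontinuous function on a compact space is bounded above.
  have hbdd (θ : Θ) : ∃ M, ∀ z, L θ z ≤ M := by
    obtain ⟨M, hM⟩ :=
      ((hL_usc θ).upperSemicontinuousOn Set.univ).bddAbove_of_isCompact isCompact_univ
    exact ⟨M, fun z => hM (Set.mem_image_of_mem _ (Set.mem_univ z))⟩
  have hint (θ : Θ) (D : ProbabilityMeasure Z) : Integrable (L θ) (D : Measure Z) := by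
    obtain ⟨M, hM⟩ := hbdd θ
    exact .of_bound (hL_usc θ).measurable.aestronglyMeasurable M
      (.of_forall fun z => by rw [Real.norm_of_nonneg (hL_nonneg θ z)]; exact hM z)
  refine ⟨fun θ D _ => hint θ D, SRWDRO.exists_isStackelbergEquilibrium (fun θ => ?_)
    fun D _ => SRWDRO.lowerSemicontinuous_expectedLoss D hL_nonneg (fun θ => hint θ D)
      (fun θ => (hL_usc θ).measurable) hL_lsc⟩
  obtain ⟨M, hM⟩ := hbdd θ
  obtain ⟨D, hD, hmax⟩ :=
    ((SRWDRO.upperSemicontinuous_integral (hL_usc θ) (hL_nonneg θ) hM).upperSemicontinuousOn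
      _).exists_isMaxOn ⟨Dn, SRWDRO.self_mem_ambiguitySet (ε := ε) (γ := γ) hp0 Dn⟩
      (SRWDRO.isCompact_ambiguitySet hp0 hγ.le Dn)
  exact ⟨D, hD, fun D' hD' => hmax hD'⟩
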